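/- **Theorem (naturality axiom).** Let $G$ be an abelian group and let $H^n$ denote singular cohomology with coefficients in $G$. For a Hausdorff space pair $(X,X_0)$ (a Hausdorff space $X$ with a subspace $X_0$), let $c(X,X_0)$ be the directed set, ordered by inclusion, of all compact subpairs $(K,K_0)$, i.e. compact sets $K\subseteq X$ and $K_0\subseteq X_0$ with $K_0\subseteq K$; let $c(X_0)$ be the directed set of compact subsets of $X_0$. The CH-shape cohomology groups are the inverse limits (with respect to the homomorphisms induced by inclusions) $$\hat H^n(X,X_0)=\varprojlim_{(K,K_0)\in c(X,X_0)}H^n(K,K_0),\qquad \hat H^n(X_0)=\varprojlim_{K_0\in c(X_0)}H^n(K_0).$$ For a map of Hausdorff pairs $\varphi:(X,X_0)\to(Y,Y_0)$ (a continuous map $\varphi:X\to Y$ with $\varphi(X_0)\subseteq Y_0$), the induced homomorphism $\hat\varphi^{\,n}:\hat H^n(Y,Y_0)\to\hat H^n(X,X_0)$ is the inverse limit of the homomorphisms $H^n(\varphi(K),\varphi(K_0))\to H^n(K,K_0)$ induced by the restrictions of $\varphi$, and $\widehat{(\varphi|_{X_0})}^{\,n}:\hat H^n(Y_0)\to\hat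 H^n(X_0)$ is defined likewise from the restrictions $K_0\to\varphi(K_0)$. The coboundary $\hat\delta^n:\hat H^n(X_0)\to\hat H^{n+1}(X,X_0)$ is the inverse limit, along the order-preserving function $(K,K_0)\mapsto K_0$, of the singular coboundary homomorphisms $\delta_{(K,K_0)}:H^n(K_0)\to H^{n+1}(K,K_0)$. Then for every map of Hausdorff pairs $\varphi:(X,X_0)\to(Y,Y_0)$ and every integer $n\ge 0$, $$\hat\delta^n\circ\widehat{(\varphi|_{X_0})}^{\,n}=\hat\varphi^{\,n+1}\circ\hat\delta^n:\ \hat H^n(Y_0)\to\hat H^{n+1}(X,X_0),$$ where $\hat\delta^n$ is that of $(X,X_0)$ on the left and that of $(Y,Y_0)$ on the right. -/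

import Mathlib

open CategoryTheory CategoryTheory.Limits TopologicalSpace

universe u

namespace CHShape

noncomputable section

/-! ### Singular cohomology of spaces and of pairs -/

/-- The integral singular chain complex functor. -/
abbrev singularChains : TopCat.{u} ⥤ ChainComplex AddCommGrpCat.{u} ℕ :=
  (AlgebraicTopology.singularChainComplexFunctor AddCommGrpCat.{u}).obj
    (AddCommGrpCat.of (ULift.{u} ℤ))

/-- The singular chains of a pair `(X, A)`: the sequence `S(A) ⟶ S(X) ⟶ S(X) / S(A)`. -/
def chainSequence (P : TopPair.{u}) : ShortComplex (ChainComplex AddCommGrpCat.{u} ℕ) :=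
  ShortComplex.mk (singularChains.map P.map) (cokernel.π (singularChains.map P.map))
    (cokernel.condition _)

/-- The map of sequences of singular chains induced by a map of pairs. -/
def chainSequenceMap {P Q : TopPair.{u}} (f : P ⟶ Q) : chainSequence P ⟶ chainSequence Q where
  τ₁ := singularChains.map (TopPair.Hom.snd f)
  τ₂ := singularChains.map (TopPair.Hom.fst f)
  τ₃ := cokernel.map _ _ (singularChains.map (TopPair.Hom.snd f))
    (singularChains.map (TopPair.Hom.fst f))
    (by rw [← Functor.map_comp, ← Functor.map_comp, TopPair.Hom.w])
  comm₁₂ := by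
    dsimp only [chainSequence]
    rw [← Functor.map_comp, ← Functor.map_comp, TopPair.Hom.w]
  comm₂₃ := by
    dsimp only [chainSequence]
    rw [cokernel.π_desc]

/-- The sequence of singular chains, as a functor on the category of pairs. -/
def chainSequenceFunctor : TopPair.{u} ⥤ ShortComplex (ChainComplex AddCommGrpCat.{u} ℕ) where
  obj := chainSequence
  map := chainSequenceMap
  map_id P := by
    have : Epi (chainSequence P).g := coequalizer.π_epi
    have h₁ : (chainSequenceMap (𝟙 P)).τ₁ = 𝟙 _ := singularChains.map_id _
    have h₂ : (chainSequenceMap (𝟙 P)).τ₂ = 𝟙 _ := singularChains.map_id _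
    refine ShortComplex.hom_ext _ _ h₁ h₂ ?_
    rw [← cancel_epi (chainSequence P).g, ← (chainSequenceMap (𝟙 P)).comm₂₃, h₂,
      ShortComplex.id_τ₃, Category.id_comp, Category.comp_id]
  map_comp {P Q R} f g := by
    have : Epi (chainSequence P).g := coequalizer.π_epi
    have h₁ : (chainSequenceMap (f ≫ g)).τ₁ = (chainSequenceMap f ≫ chainSequenceMap g).τ₁ :=
      singularChains.map_comp _ _
    have h₂ : (chainSequenceMap (f ≫ g)).τ₂ = (chainSequenceMap f ≫ chainSequenceMap g).τ₂ :=
      singularChains.map_comp _ _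
    refine ShortComplex.hom_ext _ _ h₁ h₂ ?_
    rw [← cancel_epi (chainSequence P).g, ← (chainSequenceMap (f ≫ g)).comm₂₃, h₂,
      (chainSequenceMap f ≫ chainSequenceMap g).comm₂₃]

/-- The functor `Hom(-, G)` from chain complexes to cochain complexes. -/
def dual (G : AddCommGrpCat.{u}) :
    (ChainComplex AddCommGrpCat.{u} ℕ)ᵒᵖ ⥤ CochainComplex AddCommGrpCat.{u} ℕ :=
  HomologicalComplex.opFunctor AddCommGrpCat.{u} (ComplexShape.down ℕ) ⋙
    (preadditiveYoneda.obj G).mapHomologicalComplex (ComplexShape.up ℕ)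

instance (G : AddCommGrpCat.{u}) : (dual G).Additive := by
  exact inferInstanceAs ((HomologicalComplex.opFunctor AddCommGrpCat.{u} (ComplexShape.down ℕ) ⋙
    (preadditiveYoneda.obj G).mapHomologicalComplex (ComplexShape.down ℕ).symm).Additive)

/-- The sequence of singular cochains of a pair `(X, A)` with coefficients in `G`:
`Hom(S(X) / S(A), G) ⟶ Hom(S(X), G) ⟶ Hom(S(A), G)`. -/
def cochainSequence (G : AddCommGrpCat.{u}) :
    TopPair.{u}ᵒᵖ ⥤ ShortComplex (CochainComplex AddCommGrpCat.{u} ℕ) :=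
  chainSequenceFunctor.op ⋙ ShortComplex.opFunctor _ ⋙ (dual G).mapShortComplex

/-- The `n`-th singular cohomology group `Hⁿ(X; G)` of a space. -/
def cohomology (G : AddCommGrpCat.{u}) (n : ℕ) : TopCat.{u}ᵒᵖ ⥤ AddCommGrpCat.{u} :=
  singularChains.op ⋙ dual G ⋙ HomologicalComplex.homologyFunctor _ _ n

/-- The `n`-th relative singular cohomology group `Hⁿ(X, A; G)` of a pair, the cohomology of the
complex `Hom(S(X) / S(A), G)`. -/
def relCohomology (G : AddCommGrpCat.{u}) (n : ℕ) : TopPair.{u}ᵒᵖ ⥤ AddCommGrpCat.{u} :=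
  cochainSequence G ⋙ ShortComplex.π₁ ⋙ HomologicalComplex.homologyFunctor _ _ n

open Classical in
/-- An injective map of simplicial sets induces a split monomorphism on `n`-chains. -/
theorem exists_chain_retraction {S T : SSet.{u}} (i : S ⟶ T) (n : ℕ)
    (hi : Function.Injective (i.app (Opposite.op (SimplexCategory.mk n))))
    (R : AddCommGrpCat.{u}) :
    ∃ r : (T.chainComplex R).X n ⟶ (S.chainComplex R).X n,
      (SSet.chainComplexMap i R).f n ≫ r = 𝟙 _ := by
  have e := (T.isColimitChainComplexXCofan R n).fac (Cofan.mk _ fun x ↦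
    if h : ∃ y, i.app (Opposite.op (SimplexCategory.mk n)) y = x then
      S.ιChainComplex (R := R) h.choose else 0)
  obtain ⟨r, hr⟩ : ∃ r : (T.chainComplex R).X n ⟶ (S.chainComplex R).X n,
      ∀ x, T.ιChainComplex x ≫ r =
        if h : ∃ y, i.app (Opposite.op (SimplexCategory.mk n)) y = x then
          S.ιChainComplex h.choose else 0 := ⟨_, fun x ↦ e ⟨x⟩⟩
  refine ⟨r, SSet.chainComplex_hom_ext fun y ↦ ?_⟩
  have h : ∃ z, i.app (Opposite.op (SimplexCategory.mk n)) z =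
    i.app (Opposite.op (SimplexCategory.mk n)) y := ⟨y, rfl⟩
  rw [SSet.ι_chainComplexMap_f_assoc, Category.comp_id, hr, dif_pos h, hi h.choose_spec]

theorem exists_singularChains_retraction (P : TopPair.{u}) (n : ℕ) :
    ∃ r : (singularChains.obj P.fst).X n ⟶ (singularChains.obj P.snd).X n,
      (singularChains.map P.map).f n ≫ r = 𝟙 _ := by
  have : Mono P.map := (TopCat.mono_iff_injective _).2 P.isEmbedding_map.injective
  refine exists_chain_retraction (TopCat.toSSet.map P.map) n ?_ _
  exact (CategoryTheory.mono_iff_injective _).1 inferInstance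

theorem cochainSequence_shortExact (G : AddCommGrpCat.{u}) (P : TopPair.{u}) :
    ((cochainSequence G).obj (Opposite.op P)).ShortExact := by
  refine HomologicalComplex.shortExact_of_degreewise_shortExact _ fun n ↦ ?_
  have : Mono P.map := (TopCat.mono_iff_injective _).2 P.isEmbedding_map.injective
  have hE : (chainSequence P).ShortExact :=
    { exact := ShortComplex.exact_cokernel _
      mono_f := inferInstanceAs (Mono (singularChains.map P.map))
      epi_g := coequalizer.π_epi }
  have hn := hE.map_of_exact (HomologicalComplex.eval AddCommGrpCat.{u} (ComplexShape.down ℕ) n)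
  have := hn.epi_g
  obtain ⟨r, hr⟩ := exists_singularChains_retraction P n
  let s := ShortComplex.Splitting.ofExactOfRetraction _ hn.exact r hr hn.epi_g
  exact (s.op.map (preadditiveYoneda.obj G)).shortExact

/-- The connecting homomorphism `δ : Hⁿ(A; G) ⟶ Hⁿ⁺¹(X, A; G)`, as a morphism of functors on
pairs `(X, A)`. -/
def coboundary (G : AddCommGrpCat.{u}) (n : ℕ) :
    TopPair.proj₂.op ⋙ cohomology G n ⟶ relCohomology G (n + 1) where
  app P := (cochainSequence_shortExact G P.unop).δ n (n + 1) rfl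
  naturality P Q f :=
    (HomologicalComplex.HomologySequence.δ_naturality ((cochainSequence G).map f)
      (cochainSequence_shortExact G P.unop) (cochainSequence_shortExact G Q.unop)
      n (n + 1) rfl).symm

/-! ### Inverse systems and inverse limits -/

/-- The homomorphism of inverse limits induced by a morphism `(f, α)` of inverse systems of abelian
groups: `f : J → I` is order-preserving and the components `α j : F (f j) ⟶ G j` commute with the
bonding homomorphisms. It is characterized by `lim (f, α) ≫ π j = π (f j) ≫ α j`. -/
def limHom {I J : Type u} [Preorder I] [Preorder J] {F : Iᵒᵖ ⥤ AddCommGrpCat.{u}}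
    {G : Jᵒᵖ ⥤ AddCommGrpCat.{u}} (f : J ⥤ I) (α : f.op ⋙ F ⟶ G) : limit F ⟶ limit G :=
  limit.pre F f.op ≫ limMap α

/-! ### The direct systems of compact subspaces and of compact subpairs -/

/-- The compact subpairs `(K, K₀)` of a pair `(X, A)`: compact sets `K ⊆ X` and `K₀ ⊆ A` such
that `K₀ ⊆ K`. -/
@[ext]
structure CompactSubpair (P : TopPair.{u}) where
  /-- the compact set `K ⊆ X` -/
  space : Compacts P.fst
  /-- the compact set `K₀ ⊆ A` -/
  sub : Compacts P.snd
  image_subset : P.map '' (sub : Set P.snd) ⊆ (space : Set P.fst)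

/-- Compact subpairs are ordered by inclusion: `(K, K₀) ≤ (L, L₀)` iff `K ⊆ L` and `K₀ ⊆ L₀`. -/
instance (P : TopPair.{u}) : PartialOrder (CompactSubpair P) :=
  PartialOrder.lift (fun K ↦ (K.space, K.sub)) fun _ _ h ↦
    CompactSubpair.ext (congrArg Prod.fst h) (congrArg Prod.snd h)

instance (P : TopPair.{u}) : IsDirectedOrder (CompactSubpair P) where
  directed K L := by
    refine ⟨⟨K.space ⊔ L.space, K.sub ⊔ L.sub, ?_⟩, ⟨le_sup_left, le_sup_left⟩,
      ⟨le_sup_right, le_sup_right⟩⟩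
    rw [Compacts.coe_sup, Compacts.coe_sup, Set.image_union]
    exact Set.union_subset_union K.image_subset L.image_subset

/-- The map `K ⟶ L` obtained by restricting a map `f : X ⟶ Y` with `f(K) ⊆ L`. -/
def restrict {X Y : TopCat.{u}} (f : X ⟶ Y) (K : Compacts X) (L : Compacts Y)
    (h : Set.MapsTo f K L) : TopCat.of K ⟶ TopCat.of L :=
  TopCat.ofHom ⟨h.restrict f K L, f.hom.continuous.restrict h⟩

/-- The direct system `{K}` of the compact subspaces of `X` and their inclusions. -/
def compactSystem (X : TopCat.{u}) : Compacts X ⥤ TopCat.{u} where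
  obj K := TopCat.of K
  map {K L} h := restrict (𝟙 X) K L fun _ hx ↦ leOfHom h hx

/-- A compact subpair `(K, K₀)` as a pair of spaces. -/
def CompactSubpair.toPair {P : TopPair.{u}} (K : CompactSubpair P) : TopPair.{u} :=
  TopPair.of (restrict P.map K.sub K.space (Set.mapsTo_iff_image_subset.2 K.image_subset))
    (P.isEmbedding_map.restrict (Set.mapsTo_iff_image_subset.2 K.image_subset))

/-- The map of pairs `(K, K₀) ⟶ (L, L₀)` obtained by restricting a map of pairs `φ` with
`φ(K) ⊆ L` and `φ(K₀) ⊆ L₀`. -/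
def CompactSubpair.restrictHom {P Q : TopPair.{u}} (φ : P ⟶ Q) (K : CompactSubpair P)
    (L : CompactSubpair Q) (h : Set.MapsTo (TopPair.Hom.fst φ) K.space L.space)
    (h₀ : Set.MapsTo (TopPair.Hom.snd φ) K.sub L.sub) : K.toPair ⟶ L.toPair :=
  MorphismProperty.Arrow.homMk (restrict (TopPair.Hom.snd φ) K.sub L.sub h₀)
    (restrict (TopPair.Hom.fst φ) K.space L.space h)
    (TopCat.hom_ext (ContinuousMap.ext fun x : K.sub ↦ Subtype.ext (TopPair.Hom.w_apply φ x.1)))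

/-- The direct system `C(X, A)` of the compact subpairs of `(X, A)` and their inclusions. -/
def compactPairSystem (P : TopPair.{u}) : CompactSubpair P ⥤ TopPair.{u} where
  obj K := K.toPair
  map {K L} h := CompactSubpair.restrictHom (𝟙 P) K L (fun _ hx ↦ (leOfHom h).1 hx)
    fun _ hx ↦ (leOfHom h).2 hx
  map_id _ := MorphismProperty.Arrow.Hom.ext rfl rfl
  map_comp _ _ := MorphismProperty.Arrow.Hom.ext rfl rfl

/-! ### CH-shape cohomology -/

/-- The CH-shape cohomology group `Ĥⁿ(X; G)` of a space `X`: the inverse limit of the groups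
`Hⁿ(K; G)` over the compact sets `K ⊆ X`. -/
abbrev chCohomology (G : AddCommGrpCat.{u}) (n : ℕ) (X : TopCat.{u}) : AddCommGrpCat.{u} :=
  limit ((compactSystem X).op ⋙ cohomology G n)

/-- The CH-shape cohomology group `Ĥⁿ(X, A; G)` of a pair: the inverse limit of the groups
`Hⁿ(K, K₀; G)` over the compact subpairs `(K, K₀)` of `(X, A)`. -/
abbrev chRelCohomology (G : AddCommGrpCat.{u}) (n : ℕ) (P : TopPair.{u}) : AddCommGrpCat.{u} :=
  limit ((compactPairSystem P).op ⋙ relCohomology G n)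

/-- The order-preserving function `K ↦ f(K)` on compact sets. -/
def imageFunctor {X Y : TopCat.{u}} (f : X ⟶ Y) : Compacts X ⥤ Compacts Y :=
  Monotone.functor (f := fun K : Compacts X ↦ K.map f f.hom.continuous) fun _ _ h ↦
    Set.image_mono h

/-- The restrictions `K ⟶ f(K)` of `f`, as a morphism of direct systems. -/
def compactSystemMap {X Y : TopCat.{u}} (f : X ⟶ Y) :
    compactSystem X ⟶ imageFunctor f ⋙ compactSystem Y where
  app K := restrict f K (K.map f f.hom.continuous) fun x hx ↦ ⟨x, hx, rfl⟩

/-- The homomorphism `f̂ⁿ : Ĥⁿ(Y; G) ⟶ Ĥⁿ(X; G)` induced by a map `f : X ⟶ Y`. -/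
def chMap (G : AddCommGrpCat.{u}) (n : ℕ) {X Y : TopCat.{u}} (f : X ⟶ Y) :
    chCohomology G n Y ⟶ chCohomology G n X :=
  limHom (imageFunctor f) (Functor.whiskerRight (NatTrans.op (compactSystemMap f)) (cohomology G n))

/-- The compact subpair `(φ(K), φ(K₀))`. -/
def CompactSubpair.image {P Q : TopPair.{u}} (φ : P ⟶ Q) (K : CompactSubpair P) :
    CompactSubpair Q where
  space := K.space.map (TopPair.Hom.fst φ) (TopPair.Hom.fst φ).hom.continuous
  sub := K.sub.map (TopPair.Hom.snd φ) (TopPair.Hom.snd φ).hom.continuous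
  image_subset := by
    rintro _ ⟨_, ⟨x, hx, rfl⟩, rfl⟩
    exact ⟨P.map x, K.image_subset ⟨x, hx, rfl⟩, (TopPair.Hom.w_apply φ x).symm⟩

/-- The order-preserving function `(K, K₀) ↦ (φ(K), φ(K₀))` on compact subpairs. -/
def imagePairFunctor {P Q : TopPair.{u}} (φ : P ⟶ Q) : CompactSubpair P ⥤ CompactSubpair Q :=
  Monotone.functor (f := CompactSubpair.image φ) fun _ _ h ↦
    ⟨Set.image_mono h.1, Set.image_mono h.2⟩

/-- The restrictions `(K, K₀) ⟶ (φ(K), φ(K₀))` of `φ`, as a morphism of direct systems. -/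
def compactPairSystemMap {P Q : TopPair.{u}} (φ : P ⟶ Q) :
    compactPairSystem P ⟶ imagePairFunctor φ ⋙ compactPairSystem Q where
  app K := CompactSubpair.restrictHom φ K (K.image φ) (fun x hx ↦ ⟨x, hx, rfl⟩)
    fun x hx ↦ ⟨x, hx, rfl⟩
  naturality _ _ _ := MorphismProperty.Arrow.Hom.ext rfl rfl

/-- The homomorphism `φ̂ⁿ : Ĥⁿ(Y, B; G) ⟶ Ĥⁿ(X, A; G)` induced by a map of pairs
`φ : (X, A) ⟶ (Y, B)`. -/
def chRelMap (G : AddCommGrpCat.{u}) (n : ℕ) {P Q : TopPair.{u}} (φ : P ⟶ Q) :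
    chRelCohomology G n Q ⟶ chRelCohomology G n P :=
  limHom (imagePairFunctor φ)
    (Functor.whiskerRight (NatTrans.op (compactPairSystemMap φ)) (relCohomology G n))

/-- The order-preserving function `(K, K₀) ↦ K₀`. -/
def subFunctor (P : TopPair.{u}) : CompactSubpair P ⥤ Compacts P.snd :=
  Monotone.functor (f := fun K : CompactSubpair P ↦ K.sub) fun _ _ h ↦ h.2

/-- The singular coboundaries `δ : Hⁿ(K₀; G) ⟶ Hⁿ⁺¹(K, K₀; G)` of the compact subpairs of `(X, A)`,
as a morphism of inverse systems. -/
def coboundarySystem (G : AddCommGrpCat.{u}) (n : ℕ) (P : TopPair.{u}) :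
    (subFunctor P).op ⋙ (compactSystem P.snd).op ⋙ cohomology G n ⟶
      (compactPairSystem P).op ⋙ relCohomology G (n + 1) where
  app K := (coboundary G n).app (Opposite.op K.unop.toPair)
  naturality _ _ h := (coboundary G n).naturality ((compactPairSystem P).map h.unop).op

/-- The CH-shape coboundary homomorphism `δ̂ⁿ : Ĥⁿ(A; G) ⟶ Ĥⁿ⁺¹(X, A; G)`. -/
def chCoboundary (G : AddCommGrpCat.{u}) (n : ℕ) (P : TopPair.{u}) :
    chCohomology G n P.snd ⟶ chRelCohomology G (n + 1) P :=
  limHom (subFunctor P) (coboundarySystem G n P)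

end

end CHShape

namespace CHShape

/-! A homomorphism into an inverse limit is determined by its projections, so it suffices to compare
the two composites on each compact subpair (K, K₀) of the source pair. Both routes from pairs to
compact sets send (K, K₀) to φ(K₀): restricting to K₀ and then taking the image gives the same set
as forming (φ(K), φ(K₀)) and then forgetting φ(K). Hence both composites start with the projection
of Ĥⁿ(Y₀) to Hⁿ(φ(K₀)). What remains is the square relating δ for (K, K₀) and for (φ(K), φ(K₀)),
which is the naturality of the singular coboundary (`coboundary_compactPairSystemMap`). The
projection formula `limHom_π`, specialized to the three maps involved, carries out the reduction. -/

theorem limHom_π {I J : Type u} [Preorder I] [Preorder J] {F : Iᵒᵖ ⥤ AddCommGrpCat.{u}}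
    {G : Jᵒᵖ ⥤ AddCommGrpCat.{u}} (f : J ⥤ I) (α : f.op ⋙ F ⟶ G) (j : Jᵒᵖ) :
    limHom f α ≫ limit.π G j = limit.π F (f.op.obj j) ≫ α.app j := by
  rw [limHom, Category.assoc, limMap_π, ← Category.assoc, limit.pre_π]

/-- This and the next two lemmas are instances of `limHom_π` with the index function and the
component unfolded by definition, so that the concrete compact sets and restrictions become visible.
-/
theorem chMap_π (G : AddCommGrpCat.{u}) (n : ℕ) {X Y : TopCat.{u}} (f : X ⟶ Y) (K : Compacts X) :
    chMap G n f ≫ limit.π ((compactSystem X).op ⋙ cohomology G n) (Opposite.op K) =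
      limit.π ((compactSystem Y).op ⋙ cohomology G n)
          (Opposite.op (K.map f f.hom.continuous)) ≫
        (cohomology G n).map ((compactSystemMap f).app K).op :=
  limHom_π _ _ _

theorem chRelMap_π (G : AddCommGrpCat.{u}) (n : ℕ) {P Q : TopPair.{u}} (φ : P ⟶ Q)
    (K : CompactSubpair P) :
    chRelMap G n φ ≫ limit.π ((compactPairSystem P).op ⋙ relCohomology G n) (Opposite.op K) =
      limit.π ((compactPairSystem Q).op ⋙ relCohomology G n) (Opposite.op (K.image φ)) ≫
        (relCohomology G n).map ((compactPairSystemMap φ).app K).op :=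
  limHom_π _ _ _

theorem chCoboundary_π (G : AddCommGrpCat.{u}) (n : ℕ) (P : TopPair.{u}) (K : CompactSubpair P) :
    chCoboundary G n P ≫
        limit.π ((compactPairSystem P).op ⋙ relCohomology G (n + 1)) (Opposite.op K) =
      limit.π ((compactSystem P.snd).op ⋙ cohomology G n) (Opposite.op K.sub) ≫
        (coboundary G n).app (Opposite.op K.toPair) :=
  limHom_π _ _ _

/-- The singular coboundary commutes with the restriction `(K, K₀) ⟶ (φ(K), φ(K₀))` of a map of
pairs `φ`. -/
theorem coboundary_compactPairSystemMap (G : AddCommGrpCat.{u}) (n : ℕ) {P Q : TopPair.{u}}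
    (φ : P ⟶ Q) (K : CompactSubpair P) :
    (cohomology G n).map ((compactSystemMap (TopPair.Hom.snd φ)).app K.sub).op ≫
        (coboundary G n).app (Opposite.op K.toPair) =
      (coboundary G n).app (Opposite.op (K.image φ).toPair) ≫
        (relCohomology G (n + 1)).map ((compactPairSystemMap φ).app K).op :=
  -- The second component of the map of pairs (K, K₀) ⟶ (φ(K), φ(K₀)) is by definition the
  -- restriction K₀ ⟶ φ(K₀), so this naturality square is the required one.
  (coboundary G n).naturality ((compactPairSystemMap φ).app K).op

end CHShape

theorem mainTheorem6 (G : AddCommGrpCat.{u}) (n : ℕ) (X Y : TopPair.{u}) [T2Space X.fst]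
    [T2Space Y.fst] (φ : X ⟶ Y) :
    CHShape.chMap G n (TopPair.Hom.snd φ) ≫ CHShape.chCoboundary G n X =
      CHShape.chCoboundary G n Y ≫ CHShape.chRelMap G (n + 1) φ := by
  refine limit.hom_ext fun ⟨K⟩ ↦ ?_
  rw [Category.assoc, Category.assoc, CHShape.chRelMap_π,
    ← Category.assoc (CHShape.chCoboundary G n Y), CHShape.chCoboundary_π, CHShape.chCoboundary_π]
  -- The groups Hⁿ(K₀) at which the projection ends and δ begins are written through different
  -- functors and agree only by definition; reassociation is therefore given as explicit terms.
  refine (Category.assoc _ _ _).symm.trans ((congrArg (· ≫ _)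
    (CHShape.chMap_π G n (TopPair.Hom.snd φ) K.sub)).trans ?_)
  -- Here `(K.image φ).sub` is definitionally the image of `K.sub`, so both sides begin with the
  -- same projection, and only the naturality square after it has to be applied.
  exact (Category.assoc _ _ _).trans ((congrArg
    (limit.π ((CHShape.compactSystem Y.snd).op ⋙ CHShape.cohomology G n)
      (Opposite.op (K.image φ).sub) ≫ ·)
    (CHShape.coboundary_compactPairSystemMap G n φ K)).trans (Category.assoc _ _ _).symm)
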